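/- Let $E$ and $F$ be Banach spaces over $\mathbb{K}$, where $\mathbb{K}=\mathbb{R}$ or $\mathbb{K}=\mathbb{C}$. For an integer $n\ge 1$, let $\mathcal{P}(^{n}E;F)$ be the space of all continuous $n$-homogeneous polynomials $P:E\to F$ (the maps $P(x)=A(x,\dots,x)$ with $A:E^n\to F$ continuous and $n$-linear), with the norm $\|P\|=\sup_{\|x\|\le 1}\|P(x)\|$. Let $\mathcal{P}_{K}(^{n}E;F)$ be the subspace of those $P$ that map bounded sets to relatively compact sets, and let $\mathcal{P}_{w}(^{n}E;F)$ be the subspace of those $P$ whose restriction to every bounded subset of $E$ is continuous from the weak topology of $E$ to the norm topology of $F$. A subspace $M$ of a normed space $X$ is called complemented in $X$ if there is a continuous linear projection of $X$ onto $M$. If $F$ contains a copy of $c_{0}$ (that is, a linear subspace linearly homeomorphic to $c_0$ over $\mathbb{K}$) and $E$ is infinite-dimensional, then for every integer $n\ge 1$: (a) $\mathcal{P}_{K}(^{n}E;F)$ is not complemented in $\mathcal{P}(^{n}E;F)$; (b) $\mathcal{P}_{w}(^{n}E;F)$ is not complemented in $\mathcal{P}(^{n}E;F)$. -/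

import Mathlib

open scoped ZeroAtInfty

/-- Continuous `n`-homogeneous polynomials `P : E → F`, that is, the maps of the form
`P x = A (x, …, x)` with `A` a continuous `n`-linear map. -/
structure HomogPoly (𝕜 : Type*) (n : ℕ) (E F : Type*) [RCLike 𝕜]
    [NormedAddCommGroup E] [NormedSpace 𝕜 E] [NormedAddCommGroup F] [NormedSpace 𝕜 F] where
  toFun : E → F
  exists_multilinear' :
    ∃ A : ContinuousMultilinearMap 𝕜 (fun _ : Fin n => E) F, ∀ x, toFun x = A (fun _ => x)

namespace HomogPoly

section Basic

variable {𝕜 : Type*} {n : ℕ} {E F : Type*} [RCLike 𝕜]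
  [NormedAddCommGroup E] [NormedSpace 𝕜 E] [NormedAddCommGroup F] [NormedSpace 𝕜 F]

instance instFunLike : FunLike (HomogPoly 𝕜 n E F) E F where
  coe := toFun
  coe_injective := by
    rintro ⟨f, hf⟩ ⟨g, hg⟩ h
    cases h
    rfl

theorem exists_multilinear (P : HomogPoly 𝕜 n E F) :
    ∃ A : ContinuousMultilinearMap 𝕜 (fun _ : Fin n => E) F, ∀ x, P x = A (fun _ => x) :=
  P.exists_multilinear'

@[ext]
theorem ext {P Q : HomogPoly 𝕜 n E F} (h : ∀ x, P x = Q x) : P = Q :=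
  DFunLike.ext P Q h

instance instZero : Zero (HomogPoly 𝕜 n E F) := ⟨⟨0, 0, fun _ => rfl⟩⟩

instance instAdd : Add (HomogPoly 𝕜 n E F) :=
  ⟨fun P Q => ⟨fun x => P x + Q x, by
    obtain ⟨A, hA⟩ := P.exists_multilinear
    obtain ⟨B, hB⟩ := Q.exists_multilinear
    exact ⟨A + B, fun x => by simp [hA, hB]⟩⟩⟩

instance instNeg : Neg (HomogPoly 𝕜 n E F) :=
  ⟨fun P => ⟨fun x => -P x, by
    obtain ⟨A, hA⟩ := P.exists_multilinear
    exact ⟨-A, fun x => by simp [hA]⟩⟩⟩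

instance instSub : Sub (HomogPoly 𝕜 n E F) :=
  ⟨fun P Q => ⟨fun x => P x - Q x, by
    obtain ⟨A, hA⟩ := P.exists_multilinear
    obtain ⟨B, hB⟩ := Q.exists_multilinear
    exact ⟨A - B, fun x => by simp [hA, hB]⟩⟩⟩

instance instSMul {R : Type*} [Monoid R] [DistribMulAction R F] [ContinuousConstSMul R F]
    [SMulCommClass 𝕜 R F] : SMul R (HomogPoly 𝕜 n E F) :=
  ⟨fun c P => ⟨fun x => c • P x, by
    obtain ⟨A, hA⟩ := P.exists_multilinear
    exact ⟨c • A, fun x => by simp [hA]⟩⟩⟩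

@[simp] theorem zero_apply (x : E) : (0 : HomogPoly 𝕜 n E F) x = 0 := rfl
@[simp] theorem add_apply (P Q : HomogPoly 𝕜 n E F) (x : E) : (P + Q) x = P x + Q x := rfl
@[simp] theorem neg_apply (P : HomogPoly 𝕜 n E F) (x : E) : (-P) x = -P x := rfl
@[simp] theorem sub_apply (P Q : HomogPoly 𝕜 n E F) (x : E) : (P - Q) x = P x - Q x := rfl
@[simp] theorem smul_apply (c : 𝕜) (P : HomogPoly 𝕜 n E F) (x : E) : (c • P) x = c • P x := rfl

instance instAddCommGroup : AddCommGroup (HomogPoly 𝕜 n E F) :=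
  Function.Injective.addCommGroup (fun P : HomogPoly 𝕜 n E F => (P : E → F))
    DFunLike.coe_injective rfl (fun _ _ => rfl) (fun _ => rfl) (fun _ _ => rfl)
    (fun _ _ => rfl) (fun _ _ => rfl)

instance instModule : Module 𝕜 (HomogPoly 𝕜 n E F) where
  one_smul _ := ext fun _ => one_smul _ _
  mul_smul _ _ _ := ext fun _ => mul_smul _ _ _
  smul_zero _ := ext fun _ => smul_zero _
  smul_add _ _ _ := ext fun _ => smul_add _ _ _
  add_smul _ _ _ := ext fun _ => add_smul _ _ _
  zero_smul _ := ext fun _ => zero_smul _ _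

theorem map_smul (P : HomogPoly 𝕜 n E F) (c : 𝕜) (x : E) : P (c • x) = c ^ n • P x := by
  obtain ⟨A, hA⟩ := P.exists_multilinear
  rw [hA, hA]
  simpa using A.map_smul_univ (fun _ => c) (fun _ => x)

/-- The usual norm `‖P‖ = sup {‖P x‖ : ‖x‖ ≤ 1}`. -/
noncomputable instance instNorm : Norm (HomogPoly 𝕜 n E F) :=
  ⟨fun P => ⨆ x : Metric.closedBall (0 : E) 1, ‖P x‖⟩

theorem norm_def (P : HomogPoly 𝕜 n E F) :
    ‖P‖ = ⨆ x : Metric.closedBall (0 : E) 1, ‖P x‖ := rfl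

theorem bddAbove_norm (P : HomogPoly 𝕜 n E F) :
    BddAbove (Set.range fun x : Metric.closedBall (0 : E) 1 => ‖P x‖) := by
  obtain ⟨A, hA⟩ := P.exists_multilinear
  refine ⟨‖A‖, ?_⟩
  rintro _ ⟨⟨x, hx⟩, rfl⟩
  have hx' : ‖x‖ ≤ 1 := by simpa using hx
  have h := A.le_opNorm (fun _ => x)
  simp only [Finset.prod_const, Finset.card_univ, Fintype.card_fin] at h
  simp only [hA]
  exact h.trans (mul_le_of_le_one_right (norm_nonneg A) (pow_le_one₀ (norm_nonneg x) hx'))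

theorem le_norm_of_norm_le_one (P : HomogPoly 𝕜 n E F) {x : E} (hx : ‖x‖ ≤ 1) : ‖P x‖ ≤ ‖P‖ :=
  le_ciSup (f := fun x : Metric.closedBall (0 : E) 1 => ‖P x‖) P.bddAbove_norm
    ⟨x, by simpa using hx⟩

theorem norm_le_of_forall (P : HomogPoly 𝕜 n E F) {C : ℝ}
    (h : ∀ x : E, ‖x‖ ≤ 1 → ‖P x‖ ≤ C) : ‖P‖ ≤ C := by
  have : Nonempty (Metric.closedBall (0 : E) 1) := ⟨⟨0, by simp⟩⟩
  exact ciSup_le fun x => h x (mem_closedBall_zero_iff.1 x.2)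

theorem norm_nonneg' (P : HomogPoly 𝕜 n E F) : 0 ≤ ‖P‖ :=
  (norm_nonneg (P 0)).trans (P.le_norm_of_norm_le_one (by simp))

theorem norm_smul_le' (c : 𝕜) (P : HomogPoly 𝕜 n E F) : ‖c • P‖ ≤ ‖c‖ * ‖P‖ :=
  norm_le_of_forall _ fun x hx => by
    rw [smul_apply, norm_smul]
    exact mul_le_mul_of_nonneg_left (P.le_norm_of_norm_le_one hx) (norm_nonneg c)

theorem eq_zero_of_norm_eq_zero (P : HomogPoly 𝕜 n E F) (h : ‖P‖ = 0) : P = 0 := by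
  have h1 : ∀ x : E, ‖x‖ ≤ 1 → P x = 0 := fun x hx =>
    norm_le_zero_iff.1 (h ▸ P.le_norm_of_norm_le_one hx)
  ext x
  by_cases hx : x = 0
  · exact h1 x (by simp [hx])
  · have hx' : (‖x‖ : 𝕜) ≠ 0 := by simpa using hx
    have h2 : P ((‖x‖ : 𝕜)⁻¹ • x) = 0 := h1 _ (by
      rw [norm_smul, norm_inv, RCLike.norm_coe_norm, inv_mul_cancel₀ (norm_ne_zero_iff.2 hx)])
    rw [zero_apply]
    calc P x = P ((‖x‖ : 𝕜) • ((‖x‖ : 𝕜)⁻¹ • x)) := by rw [smul_inv_smul₀ hx']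
      _ = 0 := by rw [map_smul, h2, smul_zero]

theorem normCore : NormedSpace.Core 𝕜 (HomogPoly 𝕜 n E F) where
  norm_nonneg := norm_nonneg'
  norm_smul c P := by
    refine le_antisymm (norm_smul_le' c P) ?_
    by_cases hc : c = 0
    · simpa [hc] using norm_nonneg' (0 : HomogPoly 𝕜 n E F)
    · have h := norm_smul_le' c⁻¹ (c • P)
      rw [inv_smul_smul₀ hc, norm_inv] at h
      have hc' : 0 < ‖c‖ := norm_pos_iff.2 hc
      calc ‖c‖ * ‖P‖ ≤ ‖c‖ * (‖c‖⁻¹ * ‖c • P‖) := mul_le_mul_of_nonneg_left h hc'.le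
        _ = ‖c • P‖ := by rw [mul_inv_cancel_left₀ hc'.ne']
  norm_triangle P Q := norm_le_of_forall _ fun x hx =>
    (norm_add_le (P x) (Q x)).trans
      (add_le_add (P.le_norm_of_norm_le_one hx) (Q.le_norm_of_norm_le_one hx))
  norm_eq_zero_iff P := by
    refine ⟨eq_zero_of_norm_eq_zero P, ?_⟩
    rintro rfl
    exact le_antisymm (norm_le_of_forall _ fun x _ => by simp) (norm_nonneg' _)

noncomputable instance instNormedAddCommGroup : NormedAddCommGroup (HomogPoly 𝕜 n E F) :=
  NormedAddCommGroup.ofCore normCore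

noncomputable instance instNormedSpace : NormedSpace 𝕜 (HomogPoly 𝕜 n E F) :=
  NormedSpace.ofCore normCore

end Basic

section Subspaces

variable (𝕜 : Type*) (n : ℕ) (E F : Type*) [RCLike 𝕜]
  [NormedAddCommGroup E] [NormedSpace 𝕜 E] [NormedAddCommGroup F] [NormedSpace 𝕜 F]

/-- The compact polynomials: those mapping bounded sets to relatively compact sets. -/
def compactPoly : Submodule 𝕜 (HomogPoly 𝕜 n E F) where
  carrier := {P | ∀ B : Set E, Bornology.IsBounded B → IsCompact (closure (P '' B))}
  zero_mem' B _ := by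
    refine (isCompact_singleton (x := (0 : F))).closure_of_subset ?_
    rintro _ ⟨x, _, rfl⟩
    simp
  add_mem' {P Q} hP hQ B hB := by
    refine ((hP B hB).add (hQ B hB)).closure_of_subset ?_
    rintro _ ⟨x, hx, rfl⟩
    exact Set.add_mem_add (subset_closure ⟨x, hx, rfl⟩) (subset_closure ⟨x, hx, rfl⟩)
  smul_mem' c P hP B hB := by
    refine ((hP B hB).image (continuous_const_smul c)).closure_of_subset ?_
    rintro _ ⟨x, hx, rfl⟩
    exact ⟨P x, subset_closure ⟨x, hx, rfl⟩, rfl⟩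

/-- The polynomials that are weakly continuous on bounded sets: the restriction to every bounded
set is continuous from the weak topology of `E` to the norm topology of `F`. -/
def weaklyContPoly : Submodule 𝕜 (HomogPoly 𝕜 n E F) where
  carrier := {P | ∀ B : Set E, Bornology.IsBounded B →
    ContinuousOn (fun x : WeakSpace 𝕜 E => P ((toWeakSpace 𝕜 E).symm x)) (toWeakSpace 𝕜 E '' B)}
  zero_mem' _ _ := continuousOn_const
  add_mem' hP hQ B hB := (hP B hB).add (hQ B hB)
  smul_mem' c _ hP B hB := (hP B hB).const_smul c

end Subspaces

end HomogPoly

/-- `F` contains a copy of `c₀`: some linear subspace of `F` is linearly homeomorphic to `c₀`. -/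
def ContainsCZero (𝕜 F : Type*) [RCLike 𝕜] [NormedAddCommGroup F] [NormedSpace 𝕜 F] : Prop :=
  ∃ M : Submodule 𝕜 F, Nonempty (C₀(ℕ, 𝕜) ≃L[𝕜] M)

/-! Take a bounded weak* null sequence f_k in the dual of E and points u_k of the unit ball with
|f_k(u_k)| ≥ δ > 0 (`josefson_nissenzweig`), and an embedding J of c₀ into F with bounded
functionals ψ_j on F extending the coordinates. For a in ℓ^∞ put T a (x) = J((a_k f_k(x)^n)_k)
(`diagonalPoly`). Each T e_i has the form φ^n • v and so lies in both subspaces.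

If π is a projection onto one of them and D is countable, the functionals a ↦ ψ_j((T a − π T a)(x)),
with x in D, are countably many and vanish on finitely supported sequences. Whitley's almost
disjoint argument (`exists_infinite_indicatorSeq_eq_zero`) gives an infinite M on whose indicator
all of them vanish. Thus K = π T 1_M satisfies ψ_j(K x) = f_j(x)^n for j in M and x in D
(`exists_mem_of_closedComplemented`). Compactness or weak continuity of K now clashes with f_l(u_k)
→ 0 and |f_l(u_l)| ≥ δ.

For the existence of f_k, suppose every bounded weak* null sequence in the dual of a real space is
norm null. Then every sequence in the dual ball has norm convergent tail convex combinations: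
otherwise persistent oscillation yields dyadic averages whose Rademacher coefficients obey a Bessel
inequality, hence are weak* null, yet stay bounded below. It follows that the dual ball is norm
compact, so the space is finite-dimensional. -/

open Filter Topology

/-! ### The Josefson–Nissenzweig theorem -/

section JosefsonNissenzweig

variable {E : Type*} [NormedAddCommGroup E] [NormedSpace ℝ E]

/-- Bounded sequences of functionals have weak* limits along ultrafilters. -/
theorem StrongDual.exists_tendsto_ultrafilter {g : ℕ → StrongDual ℝ E} {C : ℝ}
    (hg : ∀ m, ‖g m‖ ≤ C) (U : Ultrafilter ℕ) :
    ∃ f : StrongDual ℝ E, ∀ x, Tendsto (fun m => g m x) U (𝓝 (f x)) := by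
  have hc := WeakDual.isCompact_closedBall (𝕜 := ℝ) (E := E) 0 C
  obtain ⟨f, -, hf⟩ := hc.ultrafilter_le_nhds (U.map fun m => StrongDual.toWeakDual (g m)) (by
    rw [le_principal_iff]
    refine mem_map.2 (Filter.univ_mem' fun m => ?_)
    simpa using hg m)
  refine ⟨WeakDual.toStrongDual f, fun x => ?_⟩
  have h2 : Tendsto (fun m => StrongDual.toWeakDual (g m)) U (𝓝 f) := hf
  exact ((WeakDual.eval_continuous x).tendsto f).comp h2

/-- The limit of Rademacher-type averages of a dyadic system of functionals. -/
theorem exists_weakStar_null_of_dyadic {W : ℕ → ℕ → StrongDual ℝ E} {p q : ℕ → ℕ → ℕ} {x : ℕ → E}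
    {C δ : ℝ} (hW : ∀ m i, W (m + 1) i = (2⁻¹ : ℝ) • (W m (p m i) + W m (q m i)))
    (hC : ∀ i, ‖W 0 i‖ ≤ C) (hδ : ∀ m i, δ ≤ (W m (p m i) - W m (q m i)) (x m)) :
    ∃ f : ℕ → StrongDual ℝ E, (∀ k, ‖f k‖ ≤ C) ∧ (∀ y, Tendsto (fun k => f k y) atTop (𝓝 0)) ∧
      ∀ k, δ / 2 ≤ f k (x k) := by
  have hC0 : 0 ≤ C := (norm_nonneg _).trans (hC 0)
  -- `W m i` averages 2^m leaves `W 0 _`; `Φ m k i` is the same average with signs, plus on the `p`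
  -- branch and minus on the `q` branch of step `k`, and is 0 for `k ≥ m`.
  let Φ : ℕ → ℕ → ℕ → StrongDual ℝ E := fun m => Nat.rec (fun _ _ => 0)
    (fun m Φm k i => if k = m then (2⁻¹ : ℝ) • (W m (p m i) - W m (q m i))
      else (2⁻¹ : ℝ) • (Φm k (p m i) + Φm k (q m i))) m
  have Φs : ∀ m k i, Φ (m + 1) k i = if k = m then (2⁻¹ : ℝ) • (W m (p m i) - W m (q m i))
      else (2⁻¹ : ℝ) • (Φ m k (p m i) + Φ m k (q m i)) := fun _ _ _ => rfl
  have bessel : ∀ m i y,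
      (W m i y) ^ 2 + ∑ k ∈ Finset.range m, (Φ m k i y) ^ 2 ≤ (C * ‖y‖) ^ 2 := by
    intro m
    induction m with
    | zero =>
      intro i y
      have h1 : ‖W 0 i y‖ ≤ C * ‖y‖ := (W 0 i).le_of_opNorm_le (hC i) y
      rw [Real.norm_eq_abs] at h1
      simpa using sq_le_sq' (abs_le.1 h1).1 (abs_le.1 h1).2
    | succ m ih =>
      intro i y
      rw [Finset.sum_range_succ]
      have h1 : ∑ k ∈ Finset.range m, (Φ (m + 1) k i y) ^ 2 ≤
          2⁻¹ * (∑ k ∈ Finset.range m, (Φ m k (p m i) y) ^ 2 +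
            ∑ k ∈ Finset.range m, (Φ m k (q m i) y) ^ 2) := by
        rw [← Finset.sum_add_distrib, Finset.mul_sum]
        refine Finset.sum_le_sum fun k hk => ?_
        rw [Φs, if_neg (Finset.mem_range.1 hk).ne]
        simp only [smul_apply, add_apply, smul_eq_mul]
        nlinarith [sq_nonneg (Φ m k (p m i) y - Φ m k (q m i) y)]
      have h2 := ih (p m i) y
      have h3 := ih (q m i) y
      -- The parallelogram identity ((a+b)/2)² + ((a−b)/2)² = (a²+b²)/2 absorbs the new coefficient;
      -- convexity of the square, in `h1`, handles the old ones.
      rw [hW, Φs, if_pos rfl]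
      simp only [smul_apply, add_apply,
        sub_apply, smul_eq_mul]
      nlinarith
  have Φpair : ∀ m k i, k < m → δ / 2 ≤ Φ m k i (x k) := by
    intro m
    induction m with
    | zero => intro k i hk; omega
    | succ m ih =>
      intro k i hk
      rw [Φs]
      split_ifs with h
      · subst h
        have := hδ k i
        simp only [smul_apply, smul_eq_mul]
        linarith
      · have h1 := ih k (p m i) (by omega)
        have h2 := ih k (q m i) (by omega)
        simp only [smul_apply, add_apply, smul_eq_mul]
        linarith
  have Φzero : ∀ m k i, m ≤ k → Φ m k i = 0 := by
    intro m
    induction m with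
    | zero => intro k i _; rfl
    | succ m ih =>
      intro k i hk
      rw [Φs, if_neg (by omega), ih k _ (by omega), ih k _ (by omega)]
      simp
  have Φbd : ∀ k m, ‖Φ m k 0‖ ≤ C := by
    intro k m
    rcases le_or_gt m k with h | h
    · rw [Φzero m k 0 h, norm_zero]; exact hC0
    · refine ContinuousLinearMap.opNorm_le_bound _ hC0 fun y => ?_
      have h1 := bessel m 0 y
      have h2 := Finset.single_le_sum (f := fun k => (Φ m k 0 y) ^ 2) (fun _ _ => sq_nonneg _)
        (Finset.mem_range.2 h)
      exact abs_le_of_sq_le_sq (by nlinarith [sq_nonneg (W m 0 y)]) (by positivity)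
  choose f hf using fun k => StrongDual.exists_tendsto_ultrafilter (Φbd k) (hyperfilter ℕ)
  have hU : (hyperfilter ℕ : Filter ℕ) ≤ atTop := Nat.hyperfilter_le_atTop
  -- The Bessel bound survives the limit in depth, so the values at `y` are square summable; this is
  -- what makes `f` weak* null.
  have fsq : ∀ n y, ∑ k ∈ Finset.range n, (f k y) ^ 2 ≤ (C * ‖y‖) ^ 2 := by
    intro n y
    refine le_of_tendsto (tendsto_finsetSum _ fun k _ => (hf k y).pow 2)
      (hU (eventually_atTop.2 ⟨n, fun m hm => ?_⟩))
    refine le_trans ?_ (bessel m 0 y)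
    refine le_trans (Finset.sum_le_sum_of_subset_of_nonneg
      (Finset.range_subset_range.2 hm) fun _ _ _ => sq_nonneg _) ?_
    linarith [sq_nonneg (W m 0 y)]
  refine ⟨f, fun k => ContinuousLinearMap.opNorm_le_bound _ hC0 fun y => ?_, fun y => ?_,
    fun k => ?_⟩
  · refine le_of_tendsto (hf k y).norm (Eventually.of_forall fun m => ?_)
    exact (Φ m k 0).le_of_opNorm_le (Φbd k m) y
  · have hs : Summable fun k => (f k y) ^ 2 :=
      summable_of_sum_range_le (fun _ => sq_nonneg _) fun n => fsq n y
    have := hs.tendsto_atTop_zero.sqrt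
    simp only [Real.sqrt_sq_eq_abs, Real.sqrt_zero] at this
    exact (tendsto_zero_iff_abs_tendsto_zero _).2 this
  · exact ge_of_tendsto (hf k (x k))
      (hU (eventually_atTop.2 ⟨k + 1, fun m hm => Φpair m k 0 hm⟩))

/-- `TailConvex w z`: the late terms of `w` are convex combinations of late terms of `z`. -/
def TailConvex (w z : ℕ → StrongDual ℝ E) : Prop :=
  ∀ n, ∀ᶠ i in atTop, w i ∈ convexHull ℝ (z '' Set.Ici n)

/-- On each point of the unit ball the sequence `w` oscillates by at most `δ`. -/
def OscLE (w : ℕ → StrongDual ℝ E) (δ : ℝ) : Prop :=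
  ∀ x : E, ‖x‖ ≤ 1 → ∃ N, ∀ i ≥ N, ∀ j ≥ N, |w i x - w j x| ≤ δ

theorem TailConvex.of_le {z : ℕ → StrongDual ℝ E} {p : ℕ → ℕ} (hp : ∀ i, i ≤ p i) :
    TailConvex (fun i => z (p i)) z := fun n =>
  eventually_atTop.2 ⟨n, fun i hi => subset_convexHull ℝ _ ⟨p i, hi.trans (hp i), rfl⟩⟩

theorem TailConvex.refl (z : ℕ → StrongDual ℝ E) : TailConvex z z :=
  TailConvex.of_le (p := id) fun _ => le_rfl

theorem TailConvex.trans {u w z : ℕ → StrongDual ℝ E} (h : TailConvex u w) (h' : TailConvex w z) :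
    TailConvex u z := by
  intro n
  obtain ⟨N, hN⟩ := eventually_atTop.1 (h' n)
  filter_upwards [h N] with i hi
  refine convexHull_min ?_ (convex_convexHull ℝ _) hi
  rintro _ ⟨j, hj, rfl⟩
  exact hN j hj

/-- Evaluation at a point commutes with convex hulls, and two points of a hull are no further apart
than some two of its generators. -/
theorem TailConvex.oscLE {w z : ℕ → StrongDual ℝ E} {δ : ℝ} (h : TailConvex w z)
    (hz : OscLE z δ) : OscLE w δ := by
  intro x hx
  obtain ⟨N, hN⟩ := hz x hx
  obtain ⟨M, hM⟩ := eventually_atTop.1 (h N)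
  have key : ∀ i ≥ M, w i x ∈ convexHull ℝ ((fun j => z j x) '' Set.Ici N) := by
    intro i hi
    have h1 : ContinuousLinearMap.apply ℝ ℝ x (w i) ∈
        ContinuousLinearMap.apply ℝ ℝ x '' convexHull ℝ (z '' Set.Ici N) := ⟨_, hM i hi, rfl⟩
    have h2 := (ContinuousLinearMap.apply ℝ ℝ x).toLinearMap.image_convexHull (z '' Set.Ici N)
    rw [ContinuousLinearMap.coe_coe] at h2
    rw [h2, Set.image_image] at h1
    simpa using h1
  refine ⟨M, fun i hi j hj => ?_⟩
  obtain ⟨_, ⟨k, hk, rfl⟩, _, ⟨l, hl, rfl⟩, hd⟩ := convexHull_exists_dist_ge2 (key i hi) (key j hj)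
  rw [Real.dist_eq, Real.dist_eq] at hd
  exact hd.trans (hN k hk l hl)

theorem TailConvex.norm_le {w z : ℕ → StrongDual ℝ E} {C : ℝ} (h : TailConvex w z)
    (hz : ∀ i, ‖z i‖ ≤ C) : ∀ᶠ i in atTop, ‖w i‖ ≤ C := by
  filter_upwards [h 0] with i hi
  have : convexHull ℝ (z '' Set.Ici 0) ⊆ Metric.closedBall 0 C :=
    convexHull_min (by rintro _ ⟨j, -, rfl⟩; simpa using hz j) (convex_closedBall _ _)
  simpa using this hi

/-- If no sequence of tail convex combinations of `z` has small oscillation, then there is a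
bounded weak* null sequence that is not norm null. -/
theorem exists_weakStar_null_of_forall_not_oscLE {z : ℕ → StrongDual ℝ E} {C δ : ℝ}
    (hC : ∀ i, ‖z i‖ ≤ C) (hδ : 0 < δ) (h : ∀ w, TailConvex w z → ¬ OscLE w δ) :
    ∃ f : ℕ → StrongDual ℝ E, (∀ k, ‖f k‖ ≤ C) ∧ (∀ y, Tendsto (fun k => f k y) atTop (𝓝 0)) ∧
      ¬ Tendsto f atTop (𝓝 0) := by
  have step : ∀ w : {w // TailConvex w z}, ∃ (x : E) (p q : ℕ → ℕ), ‖x‖ ≤ 1 ∧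
      ∀ i, i ≤ p i ∧ i ≤ q i ∧ δ ≤ (w.1 (p i) - w.1 (q i)) x := by
    rintro ⟨w, hw⟩
    have := h w hw
    unfold OscLE at this
    push Not at this
    obtain ⟨x, hx, hN⟩ := this
    have : ∀ N, ∃ i j, N ≤ i ∧ N ≤ j ∧ δ ≤ (w i - w j) x := by
      intro N
      obtain ⟨i, hi, j, hj, hij⟩ := hN N
      rcases le_abs.1 hij.le with h1 | h1
      · exact ⟨i, j, hi, hj, h1⟩
      · exact ⟨j, i, hj, hi, by simpa using h1⟩
    choose p q hpq using this
    exact ⟨x, p, q, hx, hpq⟩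
  choose x p q hx hpq using step
  -- Since `i ≤ p w i` and `i ≤ q w i`, the averages are again tail convex combinations of `z`, so
  -- the oscillation hypothesis applies at every stage.
  let next : {w // TailConvex w z} → {w // TailConvex w z} := fun w =>
    ⟨fun i => (2⁻¹ : ℝ) • (w.1 (p w i) + w.1 (q w i)), TailConvex.trans (fun n =>
      eventually_atTop.2 ⟨n, fun i hi => by
        have h1 : w.1 (p w i) ∈ convexHull ℝ (w.1 '' Set.Ici n) :=
          subset_convexHull ℝ _ ⟨_, hi.trans (hpq w i).1, rfl⟩
        have h2 : w.1 (q w i) ∈ convexHull ℝ (w.1 '' Set.Ici n) :=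
          subset_convexHull ℝ _ ⟨_, hi.trans (hpq w i).2.1, rfl⟩
        rw [smul_add]
        exact convex_convexHull ℝ _ h1 h2 (by norm_num) (by norm_num) (by norm_num)⟩) w.2⟩
  let W : ℕ → {w // TailConvex w z} := fun m => Nat.rec ⟨z, TailConvex.refl z⟩ (fun _ => next) m
  obtain ⟨f, hf1, hf2, hf3⟩ := exists_weakStar_null_of_dyadic (W := fun m => (W m).1)
    (p := fun m => p (W m)) (q := fun m => q (W m)) (x := fun m => x (W m)) (C := C) (δ := δ)
    (fun m i => rfl) hC (fun m i => (hpq (W m) i).2.2)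
  refine ⟨f, hf1, hf2, fun h0 => ?_⟩
  have h1 : ∀ᶠ k in atTop, ‖f k‖ < δ / 2 := by
    have := h0.norm
    rw [norm_zero] at this
    exact this.eventually (gt_mem_nhds (by positivity))
  obtain ⟨k, hk⟩ := h1.exists
  have h2 := hf3 k
  have h3 := (f k).le_opNorm (x (W k))
  have h4 : ‖f k‖ * ‖x (W k)‖ ≤ ‖f k‖ := mul_le_of_le_one_right (norm_nonneg _) (hx _)
  linarith [Real.le_norm_self (f k (x (W k)))]

/-- Diagonalization: arbitrarily small oscillation gives vanishing oscillation. -/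
theorem exists_tailConvex_cauchySeq {z : ℕ → StrongDual ℝ E}
    (h : ∀ w, TailConvex w z → ∀ δ > 0, ∃ u, TailConvex u w ∧ OscLE u δ) :
    ∃ u, TailConvex u z ∧ ∀ x, CauchySeq fun i => u i x := by
  have step : ∀ (m : ℕ) (w : {w // TailConvex w z}), ∃ u : {w // TailConvex w z},
      TailConvex u.1 w.1 ∧ OscLE u.1 (1 / ((m : ℝ) + 1)) := by
    rintro m ⟨w, hw⟩
    obtain ⟨u, hu, hu'⟩ := h w hw (1 / ((m : ℝ) + 1)) (by positivity)
    exact ⟨⟨u, hu.trans hw⟩, hu, hu'⟩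
  choose next hn ho using step
  let W : ℕ → {w // TailConvex w z} := fun m => Nat.rec ⟨z, TailConvex.refl z⟩ next m
  have hW : ∀ m, ∀ j ≤ m, TailConvex (W m).1 (W j).1 := by
    intro m
    induction m with
    | zero => intro j hj; obtain rfl : j = 0 := by omega
              exact TailConvex.refl _
    | succ m ih =>
      intro j hj
      rcases hj.eq_or_lt with rfl | hj
      · exact TailConvex.refl _
      · exact (hn m (W m)).trans (ih j (by omega))
  -- One index serves all `j ≤ k` at once, which makes the diagonal sequence a tail convex
  -- combination of every stage.
  have hidx : ∀ k, ∃ i, ∀ j ≤ k, (W k).1 i ∈ convexHull ℝ ((W j).1 '' Set.Ici k) := by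
    intro k
    have : ∀ᶠ i in atTop, ∀ j ∈ Finset.range (k + 1),
        (W k).1 i ∈ convexHull ℝ ((W j).1 '' Set.Ici k) :=
      (Finset.eventually_all _).2 fun j hj => hW k j (by simpa [Nat.lt_succ_iff] using hj) k
    obtain ⟨i, hi⟩ := this.exists
    exact ⟨i, fun j hj => hi j (by simpa [Nat.lt_succ_iff] using hj)⟩
  choose I hI using hidx
  have hu : ∀ j, TailConvex (fun k => (W k).1 (I k)) (W j).1 := fun j n =>
    eventually_atTop.2 ⟨max j n, fun k hk => convexHull_mono
      (Set.image_mono (Set.Ici_subset_Ici.2 (le_of_max_le_right hk)))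
      (hI k j (le_of_max_le_left hk))⟩
  refine ⟨fun k => (W k).1 (I k), hu 0, ?_⟩
  have hball : ∀ x : E, ‖x‖ ≤ 1 → CauchySeq fun i => (W i).1 (I i) x := by
    intro x hx
    rw [Metric.cauchySeq_iff]
    intro ε hε
    obtain ⟨m, hm⟩ := exists_nat_one_div_lt hε
    -- Stage `m + 1` is `next m (W m)`, whence the oscillation bound 1/(m+1).
    obtain ⟨N, hN⟩ := (hu (m + 1)).oscLE (ho m (W m)) x hx
    exact ⟨N, fun i hi j hj => (hN i hi j hj).trans_lt hm⟩
  intro x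
  have h1 := hball ((‖x‖ + 1)⁻¹ • x) (by
    rw [norm_smul, norm_inv, Real.norm_of_nonneg (by positivity), inv_mul_le_iff₀ (by positivity)]
    linarith)
  have h2 : CauchySeq fun i => (‖x‖ + 1) * (W i).1 (I i) ((‖x‖ + 1)⁻¹ • x) :=
    (uniformContinuous_const_smul (‖x‖ + 1)).comp_cauchySeq h1
  have h3 : (fun i => (‖x‖ + 1) * (W i).1 (I i) ((‖x‖ + 1)⁻¹ • x)) =
      fun i => (W i).1 (I i) x := by
    funext i
    rw [map_smul, smul_eq_mul, mul_inv_cancel_left₀ (by positivity)]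
  rwa [h3] at h2

/-- A bounded pointwise Cauchy sequence of functionals converges weak* to a functional. -/
theorem StrongDual.exists_tendsto_of_cauchySeq {g : ℕ → StrongDual ℝ E} {C : ℝ}
    (hg : ∀ m, ‖g m‖ ≤ C) (hc : ∀ x, CauchySeq fun m => g m x) :
    ∃ f : StrongDual ℝ E, ∀ x, Tendsto (fun m => g m x) atTop (𝓝 (f x)) := by
  obtain ⟨f, hf⟩ := StrongDual.exists_tendsto_ultrafilter hg (hyperfilter ℕ)
  refine ⟨f, fun x => ?_⟩
  obtain ⟨a, ha⟩ := cauchySeq_tendsto_of_complete (hc x)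
  rwa [tendsto_nhds_unique (ha.mono_left Nat.hyperfilter_le_atTop) (hf x)] at ha

/-- Points that norm the closed span of a sequence of functionals, up to separation. -/
theorem StrongDual.exists_seq_separating_closure_span (y : ℕ → StrongDual ℝ E) :
    ∃ d : ℕ → E, ∀ v ∈ (Submodule.span ℝ (Set.range y)).topologicalClosure,
      (∀ n, v (d n) = 0) → v = 0 := by
  have hsep : TopologicalSpace.IsSeparable
      ((Submodule.span ℝ (Set.range y)).topologicalClosure : Set (StrongDual ℝ E)) := by
    rw [Submodule.topologicalClosure_coe]
    exact ((Set.countable_range y).isSeparable.span).closure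
  obtain ⟨c, hc, hcl⟩ := hsep
  have hne : c.Nonempty := by
    by_contra hne
    rw [Set.not_nonempty_iff_eq_empty.1 hne, closure_empty] at hcl
    exact hcl (Submodule.zero_mem _)
  obtain ⟨v, rfl⟩ := hc.exists_eq_range hne
  have hd : ∀ n, ∃ d : E, ‖d‖ ≤ 1 ∧ ‖v n‖ ≤ 2 * ‖v n d‖ := by
    intro n
    by_contra! hcon
    have h1 : ‖v n‖ ≤ ‖v n‖ / 2 :=
      ContinuousLinearMap.opNorm_le_of_unit_norm (by positivity) fun d hd => by
        linarith [hcon d hd.le]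
    have h0 := hcon 0 (by simp)
    simp at h0
    have : 0 < ‖v n‖ := norm_pos_iff.2 h0
    linarith
  choose d hd1 hd2 using hd
  refine ⟨d, fun w hw hz => ?_⟩
  by_contra hne
  have hpos : 0 < ‖w‖ := norm_pos_iff.2 hne
  -- As `w (d n) = 0` and `d n` norms `v n` up to a factor 2, ‖v n‖ ≤ 2‖w − v n‖. Hence ‖w‖ ≤ 3‖w −
  -- v n‖ < 3‖w‖/4.
  obtain ⟨_, ⟨n, rfl⟩, hn⟩ := Metric.mem_closure_iff.1 (hcl hw) (‖w‖ / 4) (by positivity)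
  rw [dist_eq_norm] at hn
  have h1 : ‖v n (d n)‖ ≤ ‖w - v n‖ := by
    have : v n (d n) = -((w - v n) (d n)) := by simp [hz n]
    rw [this, norm_neg]
    exact ((w - v n).le_opNorm _).trans (mul_le_of_le_one_right (norm_nonneg _) (hd1 n))
  have h2 := hd2 n
  have h3 : ‖w‖ ≤ ‖w - v n‖ + ‖v n‖ := by simpa using norm_add_le (w - v n) (v n)
  linarith

theorem TailConvex.mem_closure_span {w y : ℕ → StrongDual ℝ E} (h : TailConvex w y)
    {f : StrongDual ℝ E} (hf : Tendsto w atTop (𝓝 f)) :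
    f ∈ (Submodule.span ℝ (Set.range y)).topologicalClosure := by
  refine mem_closure_of_tendsto hf ?_
  filter_upwards [h 0] with i hi
  refine convexHull_min ?_ (Submodule.convex _) hi
  rintro _ ⟨j, -, rfl⟩
  exact Submodule.subset_span ⟨j, rfl⟩

/-- Tail convex combinations do not change limits. -/
theorem TailConvex.tendsto_apply {w y : ℕ → StrongDual ℝ E} (h : TailConvex w y) {x : E} {a : ℝ}
    (ha : Tendsto (fun i => y i x) atTop (𝓝 a)) : Tendsto (fun i => w i x) atTop (𝓝 a) := by
  rw [Metric.tendsto_atTop] at ha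
  refine Metric.tendsto_nhds.2 fun ε hε => ?_
  obtain ⟨N, hN⟩ := ha ε hε
  filter_upwards [h N] with i hi
  have hconv : Convex ℝ {g : StrongDual ℝ E | g x ∈ Metric.ball a ε} :=
    (convex_ball a ε).linear_preimage (ContinuousLinearMap.apply ℝ ℝ x).toLinearMap
  exact convexHull_min (by rintro _ ⟨j, hj, rfl⟩; exact hN j hj) hconv hi

/-- If all bounded sequences of functionals have norm convergent tail convex combinations, then
they have weak* convergent subsequences. -/
theorem exists_subseq_cauchySeq {y : ℕ → StrongDual ℝ E} {C : ℝ} (hC : ∀ i, ‖y i‖ ≤ C)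
    (h : ∀ z : ℕ → StrongDual ℝ E, (∀ i, ‖z i‖ ≤ C) →
      ∃ u f, TailConvex u z ∧ Tendsto u atTop (𝓝 f)) :
    ∃ s : ℕ → ℕ, StrictMono s ∧ ∀ x, CauchySeq fun i => y (s i) x := by
  obtain ⟨d, hd⟩ := StrongDual.exists_seq_separating_closure_span y
  have hK : IsCompact (Set.univ.pi fun n => Metric.closedBall (0 : ℝ) (C * ‖d n‖)) :=
    isCompact_univ_pi fun n => isCompact_closedBall _ _
  obtain ⟨a, -, s, hs, hsa⟩ := hK.tendsto_subseq (x := fun i n => y i (d n)) fun i n _ => by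
    simpa using (y i).le_of_opNorm_le (hC i) (d n)
  rw [tendsto_pi_nhds] at hsa
  refine ⟨s, hs, fun x => ?_⟩
  by_contra hx
  rw [Metric.cauchySeq_iff] at hx
  push Not at hx
  obtain ⟨ε, hε, hx⟩ := hx
  have hx' : ∀ N, ∃ i j, N ≤ i ∧ N ≤ j ∧ ε ≤ y (s i) x - y (s j) x := by
    intro N
    obtain ⟨i, hi, j, hj, hij⟩ := hx N
    rcases le_abs.1 hij with h1 | h1
    · exact ⟨i, j, hi, hj, h1⟩
    · exact ⟨j, i, hj, hi, by linarith⟩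
  -- Oscillation at `x` gives two sequences whose limits `b`, `c` there differ by at least ε. Norm
  -- limits `f`, `f'` of their convex combinations lie in the closed span and agree at every `d n`,
  -- so they coincide, a contradiction at `x`.
  choose p q hp hq hpq using hx'
  obtain ⟨b, -, r, hr, hb⟩ := (isCompact_closedBall (0 : ℝ) (C * ‖x‖)).tendsto_subseq
    (x := fun i => y (s (p i)) x) fun i => by simpa using (y _).le_of_opNorm_le (hC _) x
  obtain ⟨c, -, r', hr', hc⟩ := (isCompact_closedBall (0 : ℝ) (C * ‖x‖)).tendsto_subseq
    (x := fun i => y (s (q (r i))) x) fun i => by simpa using (y _).le_of_opNorm_le (hC _) x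
  have hbc : ε ≤ b - c := ge_of_tendsto' ((hb.comp hr'.tendsto_atTop).sub hc)
    fun i => hpq (r (r' i))
  obtain ⟨u, f, hu, hf⟩ := h (fun i => y (s (p (r i)))) fun i => hC _
  obtain ⟨u', f', hu', hf'⟩ := h (fun i => y (s (q (r (r' i))))) fun i => hC _
  have hev : ∀ x : E, Continuous fun g : StrongDual ℝ E => g x := fun x =>
    (ContinuousLinearMap.apply ℝ ℝ x).continuous
  have e1 : f x = b := tendsto_nhds_unique (((hev x).tendsto f).comp hf) (hu.tendsto_apply hb)
  have e2 : f' x = c := tendsto_nhds_unique (((hev x).tendsto f').comp hf') (hu'.tendsto_apply hc)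
  have hpt : Tendsto p atTop atTop := tendsto_atTop_mono hp tendsto_id
  have hqt : Tendsto q atTop atTop := tendsto_atTop_mono hq tendsto_id
  have t1 : TailConvex u y := hu.trans (TailConvex.of_le fun i =>
    (hr.id_le i).trans ((hp _).trans (hs.id_le _)))
  have t2 : TailConvex u' y := hu'.trans (TailConvex.of_le fun i =>
    (hr'.id_le i).trans ((hr.id_le _).trans ((hq _).trans (hs.id_le _))))
  have hff : f - f' = 0 := by
    refine hd _ (Submodule.sub_mem _ (t1.mem_closure_span hf) (t2.mem_closure_span hf')) fun n => ?_
    have e3 : f (d n) = a n := tendsto_nhds_unique (((hev (d n)).tendsto f).comp hf)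
      (hu.tendsto_apply ((hsa n).comp (hpt.comp hr.tendsto_atTop)))
    have e4 : f' (d n) = a n := tendsto_nhds_unique (((hev (d n)).tendsto f').comp hf')
      (hu'.tendsto_apply ((hsa n).comp (hqt.comp (hr.tendsto_atTop.comp hr'.tendsto_atTop))))
    simp [e3, e4]
  rw [sub_eq_zero] at hff
  rw [hff, e2] at e1
  linarith

/-- A real normed space is finite-dimensional if its dual unit ball is sequentially compact. -/
theorem finiteDimensional_of_dual_subseq
    (h : ∀ y : ℕ → StrongDual ℝ E, (∀ i, ‖y i‖ ≤ 1) →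
      ∃ (s : ℕ → ℕ) (f : StrongDual ℝ E), StrictMono s ∧ Tendsto (y ∘ s) atTop (𝓝 f)) :
    FiniteDimensional ℝ E := by
  have hK : IsCompact (Metric.closedBall (0 : StrongDual ℝ E) 1) := by
    refine IsSeqCompact.isCompact fun y hy => ?_
    obtain ⟨s, f, hs, hf⟩ := h y fun i => by simpa using hy i
    exact ⟨f, Metric.isClosed_closedBall.mem_of_tendsto hf (Eventually.of_forall fun i => hy _),
      s, hs, hf⟩
  have : FiniteDimensional ℝ (StrongDual ℝ E) :=
    FiniteDimensional.of_isCompact_closedBall ℝ one_pos hK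
  have : FiniteDimensional ℝ (StrongDual ℝ (StrongDual ℝ E)) :=
    FiniteDimensional.of_injective (ContinuousLinearMap.coeLM ℝ) ContinuousLinearMap.coe_injective
  exact FiniteDimensional.of_injective
    (NormedSpace.inclusionInDoubleDualLi ℝ (E := E)).toLinearMap
    (NormedSpace.inclusionInDoubleDualLi ℝ (E := E)).injective

/-- The Josefson–Nissenzweig theorem for real normed spaces. -/
theorem josefson_nissenzweig_real (hE : ¬ FiniteDimensional ℝ E) :
    ∃ (f : ℕ → StrongDual ℝ E) (C : ℝ), (∀ k, ‖f k‖ ≤ C) ∧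
      (∀ x, Tendsto (fun k => f k x) atTop (𝓝 0)) ∧ ¬ Tendsto f atTop (𝓝 0) := by
  by_contra! hcon
  -- Subtracting the weak* limit turns the assumption on null sequences into one on pointwise Cauchy
  -- sequences.
  have hconv : ∀ (g : ℕ → StrongDual ℝ E) (C : ℝ), (∀ k, ‖g k‖ ≤ C) →
      (∀ x, CauchySeq fun k => g k x) → ∃ f, Tendsto g atTop (𝓝 f) := by
    intro g C hC hc
    obtain ⟨f, hf⟩ := StrongDual.exists_tendsto_of_cauchySeq hC hc
    refine ⟨f, ?_⟩
    have := hcon (fun k => g k - f) (C + ‖f‖) (fun k => (norm_sub_le _ _).trans (by gcongr; exact hC k))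
      fun x => by simpa using (hf x).sub_const (f x)
    simpa using this.add_const f
  refine hE (finiteDimensional_of_dual_subseq fun y hy => ?_)
  obtain ⟨s, hs, hc⟩ := exists_subseq_cauchySeq hy fun z hz => by
    obtain ⟨u, hu, huc⟩ := exists_tailConvex_cauchySeq (z := z) fun w hw δ hδ => by
      by_contra! hno
      -- Tail convexity bounds only late terms in norm; a shift by `N` bounds them all.
      obtain ⟨N, hN⟩ := eventually_atTop.1 (hw.norm_le hz)
      have hsh : TailConvex (fun i => w (i + N)) w := TailConvex.of_le fun i => Nat.le_add_right i N
      obtain ⟨f, hf1, hf2, hf3⟩ := exists_weakStar_null_of_forall_not_oscLE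
        (z := fun i => w (i + N)) (C := 1) (fun i => hN _ (Nat.le_add_left N i)) hδ
        fun v hv => hno v (hv.trans hsh)
      exact hf3 (hcon f 1 hf1 hf2)
    obtain ⟨N, hN⟩ := eventually_atTop.1 (hu.norm_le hz)
    obtain ⟨f, hf⟩ := hconv (fun i => u (i + N)) 1 (fun i => hN _ (Nat.le_add_left N i))
      fun x => (huc x).comp_tendsto (tendsto_add_atTop_nat N)
    exact ⟨u, f, hu, (tendsto_add_atTop_iff_nat N).1 hf⟩
  obtain ⟨f, hf⟩ := hconv (y ∘ s) 1 (fun k => hy _) hc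
  exact ⟨s, f, hs, hf⟩

end JosefsonNissenzweig

/-- The Josefson–Nissenzweig theorem: the dual of an infinite-dimensional normed space contains a
bounded weak* null sequence that is bounded below in norm, witnessed by points of the unit ball. -/
theorem josefson_nissenzweig {𝕜 E : Type*} [RCLike 𝕜] [NormedAddCommGroup E] [NormedSpace 𝕜 E]
    (hE : ¬ FiniteDimensional 𝕜 E) :
    ∃ (f : ℕ → StrongDual 𝕜 E) (u : ℕ → E) (C δ : ℝ), (∀ k, ‖f k‖ ≤ C) ∧
      (∀ x, Tendsto (fun k => f k x) atTop (𝓝 0)) ∧ 0 < δ ∧ (∀ k, ‖u k‖ ≤ 1) ∧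
      ∀ k, δ ≤ ‖f k (u k)‖ := by
  let _ : NormedSpace ℝ E := NormedSpace.restrictScalars ℝ 𝕜 E
  have hE' : ¬ FiniteDimensional ℝ E := fun h => hE (FiniteDimensional.right ℝ 𝕜 E)
  obtain ⟨g, C, hC, h0, hn⟩ := josefson_nissenzweig_real hE'
  have hn' : ∃ ε > 0, ∃ᶠ k in atTop, ε ≤ ‖g k‖ := by
    by_contra! hcon
    refine hn (Metric.tendsto_nhds.2 fun ε hε => ?_)
    have := hcon ε hε
    simpa using this
  obtain ⟨ε, hε, hfr⟩ := hn'
  obtain ⟨s, hs, hsε⟩ := extraction_of_frequently_atTop hfr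
  have hu : ∀ k, ∃ u : E, ‖u‖ ≤ 1 ∧ ε / 2 ≤ ‖g (s k) u‖ := by
    intro k
    by_contra! hcon
    have h1 : ‖g (s k)‖ ≤ ε / 2 :=
      ContinuousLinearMap.opNorm_le_of_unit_norm (by positivity) fun d hd => (hcon d hd.le).le
    linarith [hsε k]
  choose u hu1 hu2 using hu
  have key : ∀ k x, ‖g k x‖ ≤ ‖((g k).extendRCLike : StrongDual 𝕜 E) x‖ := by
    intro k x
    calc ‖g k x‖ = ‖RCLike.re (((g k).extendRCLike : StrongDual 𝕜 E) x)‖ := by simp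
      _ ≤ _ := RCLike.abs_re_le_norm _
  refine ⟨fun k => (g (s k)).extendRCLike, u, C, ε / 2, fun k => ?_, fun x => ?_, by positivity,
    hu1, fun k => (hu2 k).trans (key _ _)⟩
  · simpa using hC (s k)
  · have h1 := (h0 x).comp hs.tendsto_atTop
    have h2 := (h0 ((RCLike.I : 𝕜) • x)).comp hs.tendsto_atTop
    have h3 := ((RCLike.continuous_ofReal (K := 𝕜)).tendsto 0).comp h1
    have h4 := ((RCLike.continuous_ofReal (K := 𝕜)).tendsto 0).comp h2
    have h5 := h3.sub (h4.const_mul (RCLike.I : 𝕜))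
    simpa [StrongDual.extendRCLike_apply, Function.comp_def] using h5

/-! ### Almost disjoint families and functionals on ℓ^∞ -/

/-- There is a family of infinite subsets of `ℕ`, indexed by the binary sequences, whose members
have pairwise finite intersections. -/
theorem exists_almostDisjoint_family :
    ∃ A : (ℕ → Bool) → Set ℕ, (∀ t, (A t).Infinite) ∧ ∀ s t, s ≠ t → (A s ∩ A t).Finite := by
  -- Each set is a branch of the binary tree, coded by initial segments; two branches share only the
  -- segments before they split.
  let code : (ℕ → Bool) → ℕ → ℕ := fun t n => Encodable.encode (List.ofFn fun i : Fin n => t i)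
  have hcode : ∀ s t m n, code s m = code t n → m = n ∧ ∀ i < m, s i = t i := by
    intro s t m n h
    have h1 := Encodable.encode_injective h
    have hmn : m = n := by simpa using congrArg List.length h1
    subst hmn
    exact ⟨rfl, fun i hi => congrFun (List.ofFn_injective h1) ⟨i, hi⟩⟩
  refine ⟨fun t => Set.range (code t),
    fun t => Set.infinite_range_of_injective fun m n h => (hcode t t m n h).1, fun s t hst => ?_⟩
  obtain ⟨i, hi⟩ := Function.ne_iff.1 hst
  refine ((Set.finite_Iic i).image (code s)).subset ?_
  rintro _ ⟨⟨m, rfl⟩, ⟨n, hn⟩⟩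
  obtain ⟨rfl, h⟩ := hcode t s n m hn
  refine ⟨n, ?_, rfl⟩
  by_contra hlt
  exact hi (h i (not_le.1 hlt)).symm

section Indicator

variable {𝕜 : Type*} [RCLike 𝕜]

/-- The bounded sequence that is `1` on `A` and `0` elsewhere. -/
noncomputable def indicatorSeq (𝕜 : Type*) [RCLike 𝕜] (A : Set ℕ) : BoundedContinuousFunction ℕ 𝕜 :=
  BoundedContinuousFunction.ofNormedAddCommGroupDiscrete (A.indicator 1) 1 fun k => by
    by_cases h : k ∈ A <;> simp [h]

theorem indicatorSeq_apply (A : Set ℕ) (k : ℕ) : indicatorSeq 𝕜 A k = A.indicator 1 k := rfl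

theorem map_indicatorSeq_of_finite {g : BoundedContinuousFunction ℕ 𝕜 →L[𝕜] 𝕜}
    (hg : ∀ i, g (indicatorSeq 𝕜 {i}) = 0) {A : Set ℕ} (hA : A.Finite) :
    g (indicatorSeq 𝕜 A) = 0 := by
  have h : indicatorSeq 𝕜 A = ∑ i ∈ hA.toFinset, indicatorSeq 𝕜 {i} := by
    ext k
    rw [BoundedContinuousFunction.coe_sum, Finset.sum_apply]
    have : ∀ i, indicatorSeq 𝕜 {i} k = if k = i then 1 else 0 := fun i => by
      simp [indicatorSeq_apply, Set.indicator_apply]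
    simp only [this, Finset.sum_ite_eq, indicatorSeq_apply]
    by_cases h : k ∈ A <;> simp [h]
  rw [h, map_sum]
  exact Finset.sum_eq_zero fun i _ => hg i

theorem map_indicatorSeq_diff {g : BoundedContinuousFunction ℕ 𝕜 →L[𝕜] 𝕜}
    (hg : ∀ i, g (indicatorSeq 𝕜 {i}) = 0) (A : Set ℕ) {B : Set ℕ} (hB : B.Finite) :
    g (indicatorSeq 𝕜 (A \ B)) = g (indicatorSeq 𝕜 A) := by
  have h : indicatorSeq 𝕜 A = indicatorSeq 𝕜 (A \ B) + indicatorSeq 𝕜 (A ∩ B) := by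
    ext k
    simp only [BoundedContinuousFunction.add_apply, indicatorSeq_apply]
    by_cases h1 : k ∈ A <;> by_cases h2 : k ∈ B <;> simp [h1, h2]
  rw [h, map_add, map_indicatorSeq_of_finite hg (hB.subset Set.inter_subset_right), add_zero]

/-- A functional on `ℓ^∞` vanishing on finitely supported sequences is large on at most finitely
many members of an almost disjoint family. -/
theorem card_le_of_almostDisjoint {ι : Type*} {A : ι → Set ℕ}
    (hA : ∀ s t, s ≠ t → (A s ∩ A t).Finite) {g : BoundedContinuousFunction ℕ 𝕜 →L[𝕜] 𝕜}
    (hg : ∀ i, g (indicatorSeq 𝕜 {i}) = 0) {ε : ℝ} (S : Finset ι)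
    (hS : ∀ t ∈ S, ε ≤ ‖g (indicatorSeq 𝕜 (A t))‖) : S.card * ε ≤ ‖g‖ := by
  classical
  -- Removing the finite overlap is invisible to `g` and makes the sets disjoint, so a unimodular
  -- combination of their indicators has norm at most 1.
  let B : Set ℕ := ⋃ p ∈ S.offDiag, A p.1 ∩ A p.2
  have hB : B.Finite := Set.Finite.biUnion S.offDiag.finite_toSet fun p hp =>
    hA _ _ (Finset.mem_offDiag.1 hp).2.2
  have hc : ∀ t, ∃ c : 𝕜, ‖c‖ = 1 ∧
      ‖g (indicatorSeq 𝕜 (A t))‖ = c * g (indicatorSeq 𝕜 (A t)) := fun t =>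
    RCLike.exists_norm_eq_mul_self _
  choose c hc1 hc2 using hc
  let a : BoundedContinuousFunction ℕ 𝕜 := ∑ t ∈ S, c t • indicatorSeq 𝕜 (A t \ B)
  have ha : ‖a‖ ≤ 1 := by
    refine (BoundedContinuousFunction.norm_le zero_le_one).2 fun k => ?_
    have hak : a k = ∑ t ∈ S, c t • (A t \ B).indicator 1 k := by
      simp [a, BoundedContinuousFunction.coe_sum, Finset.sum_apply, indicatorSeq_apply]
    rw [hak]
    by_cases hk : ∃ t ∈ S, k ∈ A t \ B
    · obtain ⟨t, ht, hkt⟩ := hk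
      rw [Finset.sum_eq_single_of_mem t ht]
      · simp [hkt, hc1]
      · intro s hs hst
        have : k ∉ A s \ B := fun hks => hks.2 (Set.mem_iUnion₂.2
          ⟨(s, t), Finset.mem_offDiag.2 ⟨hs, ht, hst⟩, hks.1, hkt.1⟩)
        rw [Set.indicator_of_notMem this, smul_zero]
    · push Not at hk
      rw [Finset.sum_eq_zero]
      · simp
      · intro t ht
        rw [Set.indicator_of_notMem (hk t ht), smul_zero]
  have hga : g a = ((∑ t ∈ S, ‖g (indicatorSeq 𝕜 (A t))‖ : ℝ) : 𝕜) := by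
    simp only [a, map_sum, map_smul, map_indicatorSeq_diff hg _ hB, smul_eq_mul]
    exact Finset.sum_congr rfl fun t _ => (hc2 t).symm
  have h1 : S.card * ε ≤ ∑ t ∈ S, ‖g (indicatorSeq 𝕜 (A t))‖ := by
    rw [← nsmul_eq_mul]
    exact Finset.card_nsmul_le_sum _ _ _ hS
  have h2 : ‖g a‖ = ∑ t ∈ S, ‖g (indicatorSeq 𝕜 (A t))‖ := by
    rw [hga, RCLike.norm_ofReal, abs_of_nonneg (Finset.sum_nonneg fun _ _ => norm_nonneg _)]
  have h3 : ‖g a‖ ≤ ‖g‖ := (g.le_opNorm a).trans (mul_le_of_le_one_right (norm_nonneg _) ha)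
  linarith

/-- Countably many functionals on `ℓ^∞` that vanish on the finitely supported sequences all vanish
on the indicator of some infinite set. -/
theorem exists_infinite_indicatorSeq_eq_zero {ι : Type*} [Countable ι]
    (g : ι → BoundedContinuousFunction ℕ 𝕜 →L[𝕜] 𝕜)
    (hg : ∀ m i, g m (indicatorSeq 𝕜 {i}) = 0) :
    ∃ M : Set ℕ, M.Infinite ∧ ∀ m, g m (indicatorSeq 𝕜 M) = 0 := by
  obtain ⟨A, hinf, hA⟩ := exists_almostDisjoint_family
  have hfin : ∀ m (n : ℕ), {t | 1 / ((n : ℝ) + 1) ≤ ‖g m (indicatorSeq 𝕜 (A t))‖}.Finite := by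
    intro m n
    by_contra hcon
    have hpos : 0 < 1 / ((n : ℝ) + 1) := by positivity
    obtain ⟨N, hN⟩ := exists_nat_gt (‖g m‖ / (1 / ((n : ℝ) + 1)))
    obtain ⟨S, hS, hcard⟩ := Set.Infinite.exists_subset_card_eq hcon N
    have := card_le_of_almostDisjoint hA (hg m) S fun t ht => hS ht
    rw [hcard] at this
    rw [div_lt_iff₀ hpos] at hN
    linarith
  have hcount : (⋃ m, ⋃ n : ℕ, {t | 1 / ((n : ℝ) + 1) ≤ ‖g m (indicatorSeq 𝕜 (A t))‖}).Countable :=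
    Set.countable_iUnion fun m => Set.countable_iUnion fun n => (hfin m n).countable
  -- The index set has the cardinality of the continuum, so countably many exceptional indices leave
  -- some `t` free.
  have hne : (⋃ m, ⋃ n : ℕ, {t | 1 / ((n : ℝ) + 1) ≤ ‖g m (indicatorSeq 𝕜 (A t))‖}) ≠
      Set.univ := by
    intro h
    rw [h, Set.countable_univ_iff, ← Cardinal.mk_le_aleph0_iff] at hcount
    simp only [Cardinal.mk_pi, Cardinal.mk_bool, Cardinal.prod_const] at hcount
    simp only [Cardinal.lift_id, Cardinal.mk_nat, Cardinal.two_power_aleph0] at hcount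
    exact Cardinal.aleph0_lt_continuum.not_ge hcount
  obtain ⟨t, ht⟩ := (Set.ne_univ_iff_exists_notMem _).1 hne
  refine ⟨A t, hinf t, fun m => ?_⟩
  by_contra h0
  obtain ⟨n, hn⟩ := exists_nat_one_div_lt (norm_pos_iff.2 h0)
  exact ht (Set.mem_iUnion₂.2 ⟨m, n, hn.le⟩)

end Indicator

/-! ### Diagonal polynomials with values in a copy of c₀ -/

section Diagonal

variable {𝕜 : Type*} [RCLike 𝕜] {E F : Type*}
  [NormedAddCommGroup E] [NormedSpace 𝕜 E] [NormedAddCommGroup F] [NormedSpace 𝕜 F]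

/-- A null sequence as an element of `c₀`. -/
def ZeroAtInftyContinuousMap.ofTendsto (a : ℕ → 𝕜) (ha : Tendsto a atTop (𝓝 0)) : C₀(ℕ, 𝕜) where
  toFun := a
  continuous_toFun := continuous_of_discreteTopology
  zero_at_infty' := by rwa [cocompact_eq_cofinite, Nat.cofinite_eq_atTop]

theorem ZeroAtInftyContinuousMap.norm_le_of_forall {a : C₀(ℕ, 𝕜)} {C : ℝ} (hC : 0 ≤ C)
    (h : ∀ k, ‖a k‖ ≤ C) : ‖a‖ ≤ C := by
  rw [← ZeroAtInftyContinuousMap.norm_toBCF_eq_norm]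
  exact (BoundedContinuousFunction.norm_le hC).2 h

theorem ZeroAtInftyContinuousMap.norm_apply_le (a : C₀(ℕ, 𝕜)) (k : ℕ) : ‖a k‖ ≤ ‖a‖ := by
  rw [← ZeroAtInftyContinuousMap.norm_toBCF_eq_norm]
  exact a.toBCF.norm_coe_le_norm k

/-- The coordinate functional on `c₀`. -/
noncomputable def ZeroAtInftyContinuousMap.evalCLM (k : ℕ) : C₀(ℕ, 𝕜) →L[𝕜] 𝕜 :=
  LinearMap.mkContinuous { toFun := fun a => a k, map_add' := fun _ _ => rfl,
                           map_smul' := fun _ _ => rfl } 1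
    fun a => by simpa using a.norm_apply_le k

/-- Evaluation of a homogeneous polynomial at a point. -/
noncomputable def HomogPoly.evalCLM {n : ℕ} (x : E) : HomogPoly 𝕜 n E F →L[𝕜] F :=
  LinearMap.mkContinuous { toFun := fun P => P x, map_add' := fun _ _ => rfl,
                           map_smul' := fun _ _ => rfl } (‖x‖ ^ n)
    fun P => by
      change ‖P x‖ ≤ _
      rcases eq_or_ne x 0 with rfl | hx
      · rcases eq_or_ne n 0 with rfl | hn
        · simpa using P.le_norm_of_norm_le_one (x := 0) (by simp)
        · have := P.map_smul 0 0
          rw [zero_smul, zero_pow hn, zero_smul] at this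
          simp [this, hn]
      · have hx' : (‖x‖ : 𝕜) ≠ 0 := by simpa using hx
        have h1 := P.le_norm_of_norm_le_one (x := (‖x‖ : 𝕜)⁻¹ • x) (by
          rw [norm_smul, norm_inv, RCLike.norm_coe_norm, inv_mul_cancel₀ (norm_ne_zero_iff.2 hx)])
        calc ‖P x‖ = ‖P ((‖x‖ : 𝕜) • ((‖x‖ : 𝕜)⁻¹ • x))‖ := by rw [smul_inv_smul₀ hx']
          _ = ‖x‖ ^ n * ‖P ((‖x‖ : 𝕜)⁻¹ • x)‖ := by
            rw [P.map_smul, norm_smul, norm_pow, RCLike.norm_coe_norm]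
          _ ≤ ‖x‖ ^ n * ‖P‖ := by gcongr

theorem tendsto_mul_prod_zero {n : ℕ} (hn : 1 ≤ n) {f : ℕ → StrongDual 𝕜 E}
    (h0 : ∀ x, Tendsto (fun k => f k x) atTop (𝓝 0)) (a : BoundedContinuousFunction ℕ 𝕜)
    (v : Fin n → E) : Tendsto (fun k => a k * ∏ i, f k (v i)) atTop (𝓝 0) := by
  have h1 : Tendsto (fun k => ∏ i, f k (v i)) atTop (𝓝 0) := by
    have := tendsto_finsetProd (Finset.univ : Finset (Fin n)) fun i _ => h0 (v i)
    simpa [show n ≠ 0 by omega] using this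
  have h2 : IsBoundedUnder (· ≤ ·) atTop (norm ∘ fun k => a k) :=
    isBoundedUnder_of ⟨‖a‖, fun k => a.norm_coe_le_norm k⟩
  exact isBoundedUnder_le_mul_tendsto_zero h2 h1

/-- The `c₀`-valued multilinear map `(x₁, …, xₙ) ↦ (aₖ fₖ(x₁) ⋯ fₖ(xₙ))ₖ`. -/
noncomputable def diagonalMultilinear {n : ℕ} (hn : 1 ≤ n) {f : ℕ → StrongDual 𝕜 E} {C : ℝ}
    (hC : ∀ k, ‖f k‖ ≤ C) (h0 : ∀ x, Tendsto (fun k => f k x) atTop (𝓝 0))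
    (a : BoundedContinuousFunction ℕ 𝕜) :
    ContinuousMultilinearMap 𝕜 (fun _ : Fin n => E) C₀(ℕ, 𝕜) :=
  MultilinearMap.mkContinuous
    { toFun := fun v => .ofTendsto _ (tendsto_mul_prod_zero hn h0 a v)
      map_update_add' := fun v i x y => by
        ext k
        have := ((MultilinearMap.mkPiAlgebra 𝕜 (Fin n) 𝕜).compLinearMap
          fun _ => (f k).toLinearMap).map_update_add v i x y
        change a k * _ = a k * _ + a k * _
        rw [← mul_add]
        exact congrArg _ this
      map_update_smul' := fun v i c x => by
        ext k
        have := ((MultilinearMap.mkPiAlgebra 𝕜 (Fin n) 𝕜).compLinearMap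
          fun _ => (f k).toLinearMap).map_update_smul v i c x
        change a k * _ = c • (a k * _)
        rw [smul_eq_mul, mul_left_comm]
        exact congrArg _ this }
    (‖a‖ * C ^ n) fun v => by
      have hC0 : 0 ≤ C := (norm_nonneg _).trans (hC 0)
      refine ZeroAtInftyContinuousMap.norm_le_of_forall (by positivity) fun k => ?_
      change ‖a k * ∏ i, f k (v i)‖ ≤ _
      rw [norm_mul, norm_prod, mul_assoc]
      refine mul_le_mul (a.norm_coe_le_norm k) ?_ (by positivity) (norm_nonneg _)
      calc ∏ i, ‖f k (v i)‖ ≤ ∏ i, C * ‖v i‖ :=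
            Finset.prod_le_prod (fun _ _ => norm_nonneg _)
              fun i _ => (f k).le_of_opNorm_le (hC k) (v i)
        _ = C ^ n * ∏ i, ‖v i‖ := by simp [Finset.prod_mul_distrib]

theorem diagonalMultilinear_apply {n : ℕ} (hn : 1 ≤ n) {f : ℕ → StrongDual 𝕜 E} {C : ℝ}
    (hC : ∀ k, ‖f k‖ ≤ C) (h0 : ∀ x, Tendsto (fun k => f k x) atTop (𝓝 0))
    (a : BoundedContinuousFunction ℕ 𝕜) (v : Fin n → E) (k : ℕ) :
    diagonalMultilinear hn hC h0 a v k = a k * ∏ i, f k (v i) := rfl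

/-- The operator from `ℓ^∞` to the `n`-homogeneous polynomials that sends `a` to the polynomial
`x ↦ J (aₖ fₖ(x)ⁿ)ₖ`. -/
noncomputable def diagonalPoly {n : ℕ} (hn : 1 ≤ n) {f : ℕ → StrongDual 𝕜 E} {C : ℝ}
    (hC : ∀ k, ‖f k‖ ≤ C) (h0 : ∀ x, Tendsto (fun k => f k x) atTop (𝓝 0)) (J : C₀(ℕ, 𝕜) →L[𝕜] F) :
    BoundedContinuousFunction ℕ 𝕜 →L[𝕜] HomogPoly 𝕜 n E F :=
  LinearMap.mkContinuous
    { toFun := fun a => ⟨fun x => J (diagonalMultilinear hn hC h0 a fun _ => x),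
        J.compContinuousMultilinearMap (diagonalMultilinear hn hC h0 a), fun _ => rfl⟩
      map_add' := fun a b => HomogPoly.ext fun x => by
        change J _ = J _ + J _
        rw [← map_add]
        congr 1
        ext k
        simp [diagonalMultilinear_apply, add_mul]
      map_smul' := fun c a => HomogPoly.ext fun x => by
        change J _ = c • J _
        rw [← map_smul]
        congr 1
        ext k
        simp [diagonalMultilinear_apply, mul_assoc] }
    (‖J‖ * C ^ n) fun a => by
      have hC0 : 0 ≤ C := (norm_nonneg _).trans (hC 0)
      refine HomogPoly.norm_le_of_forall _ fun x hx => ?_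
      change ‖J _‖ ≤ _
      rw [mul_assoc]
      refine J.le_opNorm_of_le (ZeroAtInftyContinuousMap.norm_le_of_forall (by positivity)
        fun k => ?_)
      rw [diagonalMultilinear_apply, norm_mul, mul_comm]
      refine mul_le_mul ?_ (a.norm_coe_le_norm k) (norm_nonneg _) (by positivity)
      rw [Finset.prod_const, Finset.card_univ, Fintype.card_fin, norm_pow]
      gcongr
      exact ((f k).le_of_opNorm_le (hC k) x).trans (mul_le_of_le_one_right hC0 hx)

theorem diagonalPoly_apply {n : ℕ} (hn : 1 ≤ n) {f : ℕ → StrongDual 𝕜 E} {C : ℝ}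
    (hC : ∀ k, ‖f k‖ ≤ C) (h0 : ∀ x, Tendsto (fun k => f k x) atTop (𝓝 0)) (J : C₀(ℕ, 𝕜) →L[𝕜] F)
    (a : BoundedContinuousFunction ℕ 𝕜) (x : E) :
    diagonalPoly hn hC h0 J a x = J (diagonalMultilinear hn hC h0 a fun _ => x) := rfl

/-- Only coordinate `i` survives. This form places the polynomial in both subspaces, where a
projection fixes it. -/
theorem diagonalPoly_indicatorSeq_singleton {n : ℕ} (hn : 1 ≤ n) {f : ℕ → StrongDual 𝕜 E} {C : ℝ}
    (hC : ∀ k, ‖f k‖ ≤ C) (h0 : ∀ x, Tendsto (fun k => f k x) atTop (𝓝 0)) (J : C₀(ℕ, 𝕜) →L[𝕜] F)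
    (i : ℕ) : ∃ v : F, ∀ x, diagonalPoly hn hC h0 J (indicatorSeq 𝕜 {i}) x = f i x ^ n • v := by
  have he : Tendsto (fun k => indicatorSeq 𝕜 {i} k) atTop (𝓝 0) := by
    refine tendsto_const_nhds.congr' (eventually_atTop.2 ⟨i + 1, fun k hk => ?_⟩)
    simp [indicatorSeq_apply, show k ≠ i by omega]
  refine ⟨J (.ofTendsto _ he), fun x => ?_⟩
  rw [diagonalPoly_apply, ← map_smul]
  congr 1
  ext k
  change indicatorSeq 𝕜 {i} k * _ = f i x ^ n • indicatorSeq 𝕜 {i} k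
  by_cases hk : k = i
  · subst hk; simp [mul_comm]
  · simp [indicatorSeq_apply, hk]

/-- A space containing `c₀` carries a bounded sequence of functionals extending the coordinate
functionals. -/
theorem ContainsCZero.exists_embedding (hF : ContainsCZero 𝕜 F) :
    ∃ (J : C₀(ℕ, 𝕜) →L[𝕜] F) (ψ : ℕ → StrongDual 𝕜 F) (C : ℝ), (∀ j, ‖ψ j‖ ≤ C) ∧
      ∀ j a, ψ j (J a) = a j := by
  obtain ⟨M, ⟨e⟩⟩ := hF
  let c : ℕ → StrongDual 𝕜 M := fun j =>
    (ZeroAtInftyContinuousMap.evalCLM j).comp (e.symm : M →L[𝕜] C₀(ℕ, 𝕜))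
  -- Norm-preserving Hahn–Banach extensions keep the bound ‖e⁻¹‖, uniform in `j`.
  choose ψ hψ hn using fun j => exists_extension_norm_eq M (c j)
  refine ⟨M.subtypeL.comp (e : C₀(ℕ, 𝕜) →L[𝕜] M), ψ, ‖(e.symm : M →L[𝕜] C₀(ℕ, 𝕜))‖,
    fun j => ?_, fun j a => ?_⟩
  · rw [hn]
    refine ContinuousLinearMap.opNorm_le_bound _ (ContinuousLinearMap.opNorm_nonneg _) fun m => ?_
    exact (ZeroAtInftyContinuousMap.norm_apply_le _ j).trans
      ((e.symm : M →L[𝕜] C₀(ℕ, 𝕜)).le_opNorm m)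
  · have := hψ j (e a)
    simp only [c] at this
    refine this.trans ?_
    change (e.symm (e a)) j = a j
    rw [e.symm_apply_apply]

/-- If a complemented subspace contains all polynomials `fⁿ • v`, then on a prescribed countable
set some member of it has the same coordinates as a diagonal polynomial of infinite support. -/
theorem exists_mem_of_closedComplemented {n : ℕ} (hn : 1 ≤ n) (hF : ContainsCZero 𝕜 F)
    {S : Submodule 𝕜 (HomogPoly 𝕜 n E F)} (hS : S.ClosedComplemented)
    (hrank : ∀ (P : HomogPoly 𝕜 n E F) (φ : StrongDual 𝕜 E) (v : F),
      (∀ x, P x = φ x ^ n • v) → P ∈ S)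
    {f : ℕ → StrongDual 𝕜 E} {C : ℝ} (hC : ∀ k, ‖f k‖ ≤ C)
    (h0 : ∀ x, Tendsto (fun k => f k x) atTop (𝓝 0)) {D : Set E} (hD : D.Countable) :
    ∃ K ∈ S, ∃ M : Set ℕ, M.Infinite ∧ ∃ (ψ : ℕ → StrongDual 𝕜 F) (B : ℝ), (∀ j, ‖ψ j‖ ≤ B) ∧
      ∀ j ∈ M, ∀ x ∈ D, ψ j (K x) = f j x ^ n := by
  obtain ⟨J, ψ, B, hB, hψ⟩ := hF.exists_embedding
  obtain ⟨π, hπ⟩ := hS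
  let T := diagonalPoly hn hC h0 J
  have : Countable D := hD
  let g : ℕ × D → BoundedContinuousFunction ℕ 𝕜 →L[𝕜] 𝕜 := fun p =>
    (ψ p.1).comp ((HomogPoly.evalCLM (p.2 : E)).comp (T - S.subtypeL.comp (π.comp T)))
  have hg : ∀ p a, g p a = ψ p.1 (T a p.2) - ψ p.1 ((π (T a) : HomogPoly 𝕜 n E F) p.2) :=
    fun p a => map_sub (ψ p.1) _ _
  obtain ⟨M, hM, hM0⟩ := exists_infinite_indicatorSeq_eq_zero g fun p i => by
    obtain ⟨v, hv⟩ := diagonalPoly_indicatorSeq_singleton hn hC h0 J i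
    have h1 := hπ ⟨T (indicatorSeq 𝕜 {i}), hrank _ _ v hv⟩
    simp only at h1
    rw [hg, h1, sub_self]
  refine ⟨π (T (indicatorSeq 𝕜 M)), (π _).2, M, hM, ψ, B, hB, fun j hj x hx => ?_⟩
  have h1 := hM0 (j, ⟨x, hx⟩)
  rw [hg, sub_eq_zero] at h1
  refine h1.symm.trans ?_
  change ψ j (T (indicatorSeq 𝕜 M) x) = _
  rw [diagonalPoly_apply, hψ, diagonalMultilinear_apply]
  simp [indicatorSeq_apply, hj]

end Diagonal

/-! ### Membership of rank-one polynomials and smallness along ultrafilters -/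

section Criterion

variable {𝕜 : Type*} [RCLike 𝕜] {E F : Type*}
  [NormedAddCommGroup E] [NormedSpace 𝕜 E] [NormedAddCommGroup F] [NormedSpace 𝕜 F]

theorem HomogPoly.mem_compactPoly_of_eq_smul {n : ℕ} {P : HomogPoly 𝕜 n E F}
    {φ : StrongDual 𝕜 E} {v : F} (hP : ∀ x, P x = φ x ^ n • v) :
    P ∈ HomogPoly.compactPoly 𝕜 n E F := by
  intro B hB
  obtain ⟨R, hR⟩ := hB.exists_norm_le
  refine ((isCompact_closedBall (0 : 𝕜) (‖φ‖ * R)).image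
    (f := fun c : 𝕜 => c ^ n • v) (by fun_prop)).closure_of_subset ?_
  rintro _ ⟨x, hx, rfl⟩
  exact ⟨φ x, by simpa using φ.le_opNorm_of_le (hR x hx), (hP x).symm⟩

theorem HomogPoly.mem_weaklyContPoly_of_eq_smul {n : ℕ} {P : HomogPoly 𝕜 n E F}
    {φ : StrongDual 𝕜 E} {v : F} (hP : ∀ x, P x = φ x ^ n • v) :
    P ∈ HomogPoly.weaklyContPoly 𝕜 n E F := by
  intro B _
  have hφ : Continuous fun x : WeakSpace 𝕜 E => φ ((toWeakSpace 𝕜 E).symm x) :=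
    WeakBilin.eval_continuous (topDualPairing 𝕜 E).flip φ
  simp only [hP]
  exact ((hφ.pow n).smul continuous_const).continuousOn

/-- A bounded sequence converges along an ultrafilter in a compact set. -/
theorem Ultrafilter.exists_tendsto_of_mem_isCompact {X : Type*} [TopologicalSpace X]
    (U : Ultrafilter ℕ) {K : Set X} (hK : IsCompact K) {u : ℕ → X} (hu : ∀ k, u k ∈ K) :
    ∃ a, Tendsto u U (𝓝 a) := by
  obtain ⟨a, -, ha⟩ := hK.ultrafilter_le_nhds (U.map u)
    (le_principal_iff.2 (mem_map.2 (Filter.univ_mem' hu)))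
  exact ⟨a, ha⟩

/-- The iterated form allows `k` to be fixed before `l` is chosen. -/
theorem eventually_eventually_norm_sub_lt {U : Filter ℕ} {u : ℕ → F} {a : F}
    (h : Tendsto u U (𝓝 a)) {ε : ℝ} (hε : 0 < ε) :
    ∀ᶠ k in U, ∀ᶠ l in U, ‖u k - u l‖ < ε := by
  have h1 : Tendsto (fun p : ℕ × ℕ => u p.1 - u p.2) (U ×ˢ U) (𝓝 (a - a)) :=
    (h.comp tendsto_fst).sub (h.comp tendsto_snd)
  rw [sub_self] at h1
  have h2 := h1.norm
  rw [norm_zero] at h2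
  exact (h2.eventually (gt_mem_nhds hε)).curry

/-- The sequence `u` need not have a weak limit in E, but every φ(u k) converges along `U`, so the
differences are weakly null along `U ×ˢ U`. They stay in the ball of radius 2, where weak continuity
at 0 applies. -/
theorem HomogPoly.eventually_norm_apply_sub_lt {n : ℕ} (hn : 1 ≤ n) {P : HomogPoly 𝕜 n E F}
    (hP : P ∈ HomogPoly.weaklyContPoly 𝕜 n E F) (U : Ultrafilter ℕ) {u : ℕ → E}
    (hu : ∀ k, ‖u k‖ ≤ 1) {ε : ℝ} (hε : 0 < ε) :
    ∀ᶠ k in (U : Filter ℕ), ∀ᶠ l in (U : Filter ℕ), ‖P (u k - u l)‖ < ε := by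
  have hw : Tendsto (fun p : ℕ × ℕ => toWeakSpace 𝕜 E (u p.1 - u p.2)) (U ×ˢ U)
      (𝓝 (toWeakSpace 𝕜 E 0)) := by
    rw [map_zero]
    have hnhds : 𝓝 (0 : WeakSpace 𝕜 E) =
        comap (fun (x : WeakSpace 𝕜 E) φ => (topDualPairing 𝕜 E).flip x φ) (𝓝 _) :=
      nhds_induced _ _
    rw [hnhds]
    refine tendsto_comap_iff.2 (tendsto_pi_nhds.2 fun φ => ?_)
    obtain ⟨a, ha⟩ := U.exists_tendsto_of_mem_isCompact (isCompact_closedBall (0 : 𝕜) ‖φ‖)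
      (u := fun k => φ (u k)) fun k => by
        simpa using (φ.le_opNorm (u k)).trans (mul_le_of_le_one_right (norm_nonneg _) (hu k))
    have h1 := (ha.comp tendsto_fst).sub (ha.comp (tendsto_snd (f := (U : Filter ℕ))))
    rw [sub_self] at h1
    refine (h1.congr fun p => ?_).trans (le_of_eq ?_)
    · exact (map_sub φ _ _).symm
    · exact congrArg 𝓝 (map_zero φ).symm
  have hB : Bornology.IsBounded (Metric.closedBall (0 : E) 2) := Metric.isBounded_closedBall
  have h0 : (0 : E) ∈ Metric.closedBall (0 : E) 2 := by simp
  have hc := hP _ hB (toWeakSpace 𝕜 E 0) ⟨0, h0, rfl⟩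
  have h2 := hc.tendsto.comp (tendsto_nhdsWithin_iff.2 ⟨hw, Eventually.of_forall fun p =>
    ⟨u p.1 - u p.2, by
      have := norm_sub_le (u p.1) (u p.2)
      simp only [mem_closedBall_zero_iff]
      linarith [hu p.1, hu p.2], rfl⟩⟩)
  have hP0 : P 0 = 0 := by
    have := P.map_smul 0 0
    rwa [zero_smul, zero_pow (by omega), zero_smul] at this
  have h3 := h2.norm
  simp only [LinearEquiv.symm_apply_apply, hP0, norm_zero, Function.comp_def] at h3
  exact (h3.eventually (gt_mem_nhds hε)).curry

end Criterion

/-! ### The two contradictions -/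

theorem mainTheorem7 {𝕜 : Type*} [RCLike 𝕜] {E F : Type*}
    [NormedAddCommGroup E] [NormedSpace 𝕜 E] [CompleteSpace E]
    [NormedAddCommGroup F] [NormedSpace 𝕜 F] [CompleteSpace F]
    (hF : ContainsCZero 𝕜 F) (hE : ¬ FiniteDimensional 𝕜 E) (n : ℕ) (hn : 1 ≤ n) :
    ¬ (HomogPoly.compactPoly 𝕜 n E F).ClosedComplemented ∧
      ¬ (HomogPoly.weaklyContPoly 𝕜 n E F).ClosedComplemented := by
  obtain ⟨f, u, C, δ, hC, h0, hδ, hu, hfu⟩ := josefson_nissenzweig hE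
  have hn0 : n ≠ 0 := by omega
  have hsmall : ∀ {B : ℝ}, 0 ≤ B → B * (δ ^ n / (2 * (B + 1))) ≤ δ ^ n / 2 := by
    intro B hB
    rw [mul_div_assoc', div_le_div_iff₀ (by positivity) (by positivity)]
    have := pow_pos hδ n
    nlinarith
  constructor
  · intro hS
    obtain ⟨K, hK, M, hM, ψ, B, hB, hψ⟩ := exists_mem_of_closedComplemented hn hF hS
      (fun P φ v hP => HomogPoly.mem_compactPoly_of_eq_smul hP) hC h0 (Set.countable_range u)
    have hB0 : 0 ≤ B := (norm_nonneg _).trans (hB 0)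
    let m := Nat.nth (· ∈ M)
    have hm : ∀ k, m k ∈ M := Nat.nth_mem_of_infinite hM
    have hmono : StrictMono m := Nat.nth_strictMono hM
    obtain ⟨a, ha⟩ := (hyperfilter ℕ).exists_tendsto_of_mem_isCompact
      (hK _ (Metric.isBounded_closedBall (x := (0 : E)) (r := 1))) (u := fun k => K (u (m k)))
      fun k => subset_closure ⟨u (m k), by simpa using hu (m k), rfl⟩
    obtain ⟨k, hk⟩ := (eventually_eventually_norm_sub_lt ha
      (ε := δ ^ n / (2 * (B + 1))) (by positivity)).exists
    have h1 : Tendsto (fun l => ‖f (m l) (u (m k)) ^ n‖) (hyperfilter ℕ) (𝓝 0) := by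
      have := (((h0 (u (m k))).comp hmono.tendsto_atTop).pow n).norm
      rw [zero_pow hn0, norm_zero] at this
      exact this.mono_left Nat.hyperfilter_le_atTop
    -- With `k` fixed, weak* nullity makes the cross term small, while the diagonal term at `l` has
    -- norm at least δ^n.
    obtain ⟨l, hl, hl'⟩ := (hk.and (h1.eventually (gt_mem_nhds
      (show 0 < δ ^ n / 2 by positivity)))).exists
    have h2 : f (m l) (u (m k)) ^ n - f (m l) (u (m l)) ^ n =
        ψ (m l) (K (u (m k)) - K (u (m l))) := by
      rw [map_sub, hψ _ (hm l) _ ⟨_, rfl⟩, hψ _ (hm l) _ ⟨_, rfl⟩]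
    have h3 := (ψ (m l)).le_of_opNorm_le (hB _) (K (u (m k)) - K (u (m l)))
    rw [← h2] at h3
    have h4 : δ ^ n ≤ ‖f (m l) (u (m l)) ^ n‖ := by
      rw [norm_pow]; gcongr; exact hfu _
    have h5 := norm_sub_norm_le (f (m l) (u (m l)) ^ n) (f (m l) (u (m k)) ^ n)
    rw [norm_sub_rev] at h5
    have h6 := mul_le_mul_of_nonneg_left hl.le hB0
    linarith [hsmall hB0]
  · intro hS
    -- Differences are prescribed as points because smallness is available for K(u_k − u_l), and `K`
    -- need not be additive.
    obtain ⟨K, hK, M, hM, ψ, B, hB, hψ⟩ := exists_mem_of_closedComplemented hn hF hS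
      (fun P φ v hP => HomogPoly.mem_weaklyContPoly_of_eq_smul hP) hC h0
      (Set.countable_range fun p : ℕ × ℕ => u p.1 - u p.2)
    have hB0 : 0 ≤ B := (norm_nonneg _).trans (hB 0)
    let m := Nat.nth (· ∈ M)
    have hm : ∀ k, m k ∈ M := Nat.nth_mem_of_infinite hM
    have hmono : StrictMono m := Nat.nth_strictMono hM
    obtain ⟨k, hk⟩ := (HomogPoly.eventually_norm_apply_sub_lt hn hK (hyperfilter ℕ)
      (u := fun k => u (m k)) (fun k => hu _) (ε := (δ / 2) ^ n / (B + 1)) (by positivity)).exists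
    have h1 : Tendsto (fun l => ‖f (m l) (u (m k))‖) (hyperfilter ℕ) (𝓝 0) := by
      have := ((h0 (u (m k))).comp hmono.tendsto_atTop).norm
      rw [norm_zero] at this
      exact this.mono_left Nat.hyperfilter_le_atTop
    obtain ⟨l, hl, hl'⟩ := (hk.and (h1.eventually (gt_mem_nhds
      (show 0 < δ / 2 by positivity)))).exists
    have h3 := (ψ (m l)).le_of_opNorm_le (hB _) (K (u (m k) - u (m l)))
    rw [hψ _ (hm l) _ ⟨(m k, m l), rfl⟩, norm_pow, map_sub] at h3
    have h5 := norm_sub_norm_le (f (m l) (u (m l))) (f (m l) (u (m k)))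
    rw [norm_sub_rev] at h5
    have h6 : (δ / 2) ^ n ≤ ‖f (m l) (u (m k)) - f (m l) (u (m l))‖ ^ n := by
      gcongr
      linarith [hfu (m l)]
    -- With κ = ‖K(u_{m k} − u_{m l})‖, the bounds (δ/2)^n ≤ Bκ and κ(B + 1) < (δ/2)^n conflict; `B
    -- + 1` avoids division by zero.
    rw [lt_div_iff₀ (by positivity)] at hl
    have h7 : 0 < (δ / 2) ^ n := by positivity
    nlinarith [norm_nonneg (K (u (m k) - u (m l)))]
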